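/- Let $n,d,X,Y$ be integers with $d\ge 1$, $Y\ge 1$ and $0\le X\le Y$, and suppose that at least one (simple, labelled) $d$-regular graph on the vertex set $V=\{1,\dots,n\}$ exists. Let $G$ be chosen uniformly at random from the set of all $d$-regular graphs on $V$. For disjoint sets $S,T\subseteq V$ let $E(S,T)$ denote the number of edges of $G$ with one end in $S$ and the other in $T$. Then, with probability at least $1-2e^{-Y}$, every pair of disjoint sets $S,T\subseteq V$ with $|S|=X$ and $|T|=Y$ satisfies $$\left|E(S,T)-\frac{dXY}{n}\right|\;\le\; d\sqrt{XY}\,\sqrt{\frac{24}{d}\log\frac{ne}{Y}+\frac{160\,d}{Y}},$$ where $\log$ is the natural logarithm. -/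

import Mathlib

/-- The number `E(S, T)` of edges of `G` with one end in `S` and the other in `T`, for disjoint
`S` and `T` (each such edge is then exactly one pair `(s, t)` with `s ∈ S`, `t ∈ T` adjacent). -/
noncomputable def edgesBetween {n : ℕ} (G : SimpleGraph (Fin n)) (S T : Finset (Fin n)) : ℕ :=
  open Classical in (G.interedges S T).card

/-- The finite set of all (labelled, simple) `d`-regular graphs on the vertex set `Fin n`. -/
noncomputable def regularGraphs (n d : ℕ) : Finset (SimpleGraph (Fin n)) :=
  open Classical in Finset.univ.filter (fun G => G.IsRegularOfDegree d)

/-- The random `d`-regular `n`-vertex graph: the uniform distribution on the set of all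
`d`-regular graphs on `Fin n`, which makes sense when there is at least one. -/
noncomputable def randomRegularGraph (n d : ℕ) (h : (regularGraphs n d).Nonempty) :
    PMF (SimpleGraph (Fin n)) :=
  PMF.uniformOfFinset (regularGraphs n d) h

/-! ### Edge switchings as linear changes of the adjacency indicator. -/

section Switching

/-! Fix disjoint S, T and let F(G) = E(S,T), with m = d|S||T|/n. The proof is Stein's method of
exchangeable pairs, the pair being G and the graph obtained by switching two of its darts st, uv to
sv, ut. Summed over all pairs of darts, the decrease of F is exactly 4nd(F - m)
(`sum_darts_switchDiff`), so a switching pulls F linearly towards m. At most 2nd(d + d²) pairs of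
darts fail to be switchable, which costs a bias of order d².

On regular graphs switching is an involution of the switchable configurations
(`sum_switchable_comm`), so the sum of the decrease times exp(kF) can be antisymmetrised into a sum
of (F - F')(exp(kF) - exp(kF')), at most |k| times a quadratic sum. Since F and m are at most d|S|,
`abs_sum_edgeWeight_sub_mul_exp_le` bounds the logarithmic derivative of the moment generating
function of ±(F - m) by 4d|S|l + d + d². Integration and Chernoff's bound give
`card_edgesBetween_tail_le`.

With L = log(ne/Y), the constants 24 and 160 make each pair (S,T) fail with probability at most
2exp(-3YL). There are at most exp(2YL) pairs, and L ≥ 1, so a union bound leaves 2exp(-Y). -/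

open scoped Classical in
/-- The adjacency indicator of a graph, with real values. -/
noncomputable def adjInd {V : Type*} (G : SimpleGraph V) (x y : V) : ℝ :=
  if G.Adj x y then 1 else 0

open scoped Classical in
/-- The indicator of the two darts between `p` and `q`. -/
noncomputable def pairInd {V : Type*} (p q x y : V) : ℝ :=
  (if x = p ∧ y = q then 1 else 0) + (if x = q ∧ y = p then 1 else 0)

/-- The edges `st` and `uv` of `G` can be replaced by `sv` and `ut`. -/
structure Switchable {V : Type*} (G : SimpleGraph V) (s t u v : V) : Prop where
  adj_st : G.Adj s t
  adj_uv : G.Adj u v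
  not_adj_sv : ¬ G.Adj s v
  not_adj_ut : ¬ G.Adj u t
  ne_sv : s ≠ v
  ne_ut : u ≠ t

/-- Replace the edges `st` and `uv` of `G` by `sv` and `ut`. -/
def switchEdges {V : Type*} (G : SimpleGraph V) (s t u v : V) : SimpleGraph V :=
  G.deleteEdges {s(s, t), s(u, v)} ⊔ SimpleGraph.edge s v ⊔ SimpleGraph.edge u t

variable {V : Type*} {G : SimpleGraph V} {s t u v : V}

lemma adjInd_nonneg (G : SimpleGraph V) (x y : V) : 0 ≤ adjInd G x y := by
  unfold adjInd; split_ifs <;> norm_num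

lemma adjInd_le_one (G : SimpleGraph V) (x y : V) : adjInd G x y ≤ 1 := by
  unfold adjInd; split_ifs <;> norm_num

open scoped Classical in
lemma adjInd_comm (G : SimpleGraph V) (x y : V) : adjInd G x y = adjInd G y x := by
  unfold adjInd
  exact if_congr (G.adj_comm x y) rfl rfl

lemma adjInd_injective : Function.Injective (adjInd : SimpleGraph V → V → V → ℝ) := by
  intro G H h
  ext x y
  have := congrFun (congrFun h x) y
  unfold adjInd at this
  split_ifs at this <;> simp_all

lemma Switchable.ne_su (h : Switchable G s t u v) : s ≠ u := by
  rintro rfl; exact h.not_adj_ut h.adj_st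

lemma Switchable.ne_tv (h : Switchable G s t u v) : t ≠ v := by
  rintro rfl; exact h.not_adj_sv h.adj_st

-- Switchability forces s, t, u, v to be distinct, so the four edges involved do not interact and
-- the switching is linear in the indicator. Preservation of degrees, reversibility and the change
-- of weight then become algebra.
open scoped Classical in
lemma Switchable.adjInd_switchEdges (h : Switchable G s t u v) (x y : V) :
    adjInd (switchEdges G s t u v) x y =
      adjInd G x y - pairInd s t x y - pairInd u v x y + pairInd s v x y + pairInd u t x y := by
  have h1 := h.adj_st
  have h2 := h.adj_uv
  have h3 := h.not_adj_sv
  have h4 := h.not_adj_ut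
  have n1 := h.ne_sv
  have n2 := h.ne_ut
  have n3 := h.ne_su
  have n4 := h.ne_tv
  have n5 := h1.ne
  have n6 := h2.ne
  have h1' := h1.symm
  have h2' := h2.symm
  have h3' : ¬ G.Adj v s := fun k => h3 k.symm
  have h4' : ¬ G.Adj t u := fun k => h4 k.symm
  unfold adjInd pairInd switchEdges
  simp only [SimpleGraph.sup_adj, SimpleGraph.deleteEdges_adj, SimpleGraph.edge_adj,
    Set.mem_insert_iff, Set.mem_singleton_iff, Sym2.eq_iff]
  by_cases a1 : x = s
  · subst a1
    by_cases b1 : y = t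
    · subst b1; simp [*, Ne.symm]
    by_cases b2 : y = v
    · subst b2; simp [*, Ne.symm]
    simp [*, Ne.symm]
  by_cases a2 : x = t
  · subst a2
    by_cases b1 : y = s
    · subst b1; simp [*, Ne.symm]
    by_cases b2 : y = u
    · subst b2; simp [*, Ne.symm]
    simp [*, Ne.symm]
  by_cases a3 : x = u
  · subst a3
    by_cases b1 : y = t
    · subst b1; simp [*, Ne.symm]
    by_cases b2 : y = v
    · subst b2; simp [*, Ne.symm]
    simp [*, Ne.symm]
  by_cases a4 : x = v
  · subst a4
    by_cases b1 : y = s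
    · subst b1; simp [*, Ne.symm]
    by_cases b2 : y = u
    · subst b2; simp [*, Ne.symm]
    simp [*, Ne.symm]
  simp [*]

lemma Switchable.switchEdges (h : Switchable G s t u v) :
    Switchable (switchEdges G s t u v) s v u t := by
  have n3 := h.ne_su
  have n4 := h.ne_tv
  have n5 := h.adj_st.ne
  have n6 := h.adj_uv.ne
  have n1 := h.ne_sv
  have n2 := h.ne_ut
  constructor <;>
    simp [_root_.switchEdges, SimpleGraph.edge_adj, n1, n2, n3, n4, n5, n6, n1.symm, n2.symm,
      n3.symm, n4.symm, n5.symm, n6.symm]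

lemma Switchable.switchEdges_switchEdges (h : Switchable G s t u v) :
    _root_.switchEdges (_root_.switchEdges G s t u v) s v u t = G := by
  apply adjInd_injective
  funext x y
  rw [h.switchEdges.adjInd_switchEdges, h.adjInd_switchEdges]
  ring

variable [Fintype V]

lemma sum_pairInd_mul (p q : V) (g : V → V → ℝ) :
    ∑ x, ∑ y, pairInd p q x y * g x y = g p q + g q p := by
  classical
  simp [pairInd, add_mul, Finset.sum_add_distrib, ite_and]

open scoped Classical in
lemma sum_pairInd (p q x : V) :
    ∑ y, pairInd p q x y = (if x = p then 1 else 0) + (if x = q then 1 else 0) := by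
  simp [pairInd, Finset.sum_add_distrib, ite_and]

open scoped Classical in
lemma isRegularOfDegree_iff_sum_adjInd (G : SimpleGraph V) (d : ℕ) :
    G.IsRegularOfDegree d ↔ ∀ x, ∑ y, adjInd G x y = d := by
  refine forall_congr' fun x => ?_
  rw [← G.card_neighborFinset_eq_degree, G.neighborFinset_eq_filter]
  simp only [adjInd, Finset.sum_boole]
  norm_cast

open scoped Classical in
lemma Switchable.isRegularOfDegree (h : Switchable G s t u v) {d : ℕ}
    (hG : G.IsRegularOfDegree d) : (_root_.switchEdges G s t u v).IsRegularOfDegree d := by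
  rw [isRegularOfDegree_iff_sum_adjInd] at hG ⊢
  intro x
  simp only [h.adjInd_switchEdges, Finset.sum_add_distrib, Finset.sum_sub_distrib, sum_pairInd, hG]
  ring

lemma Switchable.sum_adjInd_mul (h : Switchable G s t u v) (g : V → V → ℝ) :
    ∑ x, ∑ y, adjInd (_root_.switchEdges G s t u v) x y * g x y =
      ∑ x, ∑ y, adjInd G x y * g x y
        - ((g s t + g t s) + (g u v + g v u) - (g s v + g v s) - (g u t + g t u)) := by
  simp only [h.adjInd_switchEdges, add_mul, sub_mul, Finset.sum_add_distrib,
    Finset.sum_sub_distrib, sum_pairInd_mul]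
  ring

end Switching

/-! ### Exponential moments, tail bounds and a binomial estimate. -/

section Concentration

/-- A differential inequality for the moment generating function gives a sub-Gaussian bound. -/
lemma sum_exp_le_of_sum_mul_exp_le {ι : Type*} (R : Finset ι) (f : ι → ℝ) (a b : ℝ)
    (h : ∀ l : ℝ, 0 ≤ l →
      ∑ i ∈ R, f i * Real.exp (l * f i) ≤ (2 * a * l + b) * ∑ i ∈ R, Real.exp (l * f i))
    {l : ℝ} (hl : 0 ≤ l) :
    ∑ i ∈ R, Real.exp (l * f i) ≤ R.card * Real.exp (a * l ^ 2 + b * l) := by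
  -- The integrating factor turns the differential inequality into monotonicity of M on [0, ∞).
  set M : ℝ → ℝ := fun x => (∑ i ∈ R, Real.exp (x * f i)) * Real.exp (-(a * x ^ 2 + b * x)) with hM
  have hd : ∀ x, HasDerivAt M
      ((∑ i ∈ R, f i * Real.exp (x * f i) - (2 * a * x + b) * ∑ i ∈ R, Real.exp (x * f i)) *
        Real.exp (-(a * x ^ 2 + b * x))) x := by
    intro x
    have h1 : HasDerivAt (fun x => ∑ i ∈ R, Real.exp (x * f i))
        (∑ i ∈ R, Real.exp (x * f i) * f i) x := by
      apply HasDerivAt.fun_sum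
      intro i _
      have := ((hasDerivAt_id x).mul_const (f i)).exp
      rw [one_mul] at this
      exact this
    have h2 : HasDerivAt (fun x : ℝ => Real.exp (-(a * x ^ 2 + b * x)))
        (Real.exp (-(a * x ^ 2 + b * x)) * (-(2 * a * x + b))) x := by
      apply HasDerivAt.exp
      refine (((hasDerivAt_pow 2 x).const_mul a).add
        ((hasDerivAt_id x).const_mul b)).neg.congr_deriv ?_
      norm_num
      ring
    refine (h1.mul h2).congr_deriv ?_
    simp only [mul_comm (f _)]
    ring
  have hanti : AntitoneOn M (Set.Ici 0) := by
    apply antitoneOn_of_deriv_nonpos (convex_Ici 0)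
    · exact fun x _ => (hd x).continuousAt.continuousWithinAt
    · exact fun x _ => (hd x).differentiableAt.differentiableWithinAt
    · intro x hx
      rw [interior_Ici] at hx
      rw [(hd x).deriv]
      exact mul_nonpos_of_nonpos_of_nonneg (sub_nonpos.2 (h x (le_of_lt hx))) (Real.exp_nonneg _)
  have hle := hanti (Set.mem_Ici.2 le_rfl) (Set.mem_Ici.2 hl) hl
  simp only [hM, zero_mul, Real.exp_zero, Finset.sum_const, nsmul_eq_mul, mul_one] at hle
  norm_num at hle
  calc ∑ i ∈ R, Real.exp (l * f i)
      = (∑ i ∈ R, Real.exp (l * f i)) * Real.exp (-(a * l ^ 2 + b * l))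
          * Real.exp (a * l ^ 2 + b * l) := by
        rw [mul_assoc, ← Real.exp_add]; simp
    _ ≤ _ := by
        refine mul_le_mul_of_nonneg_right ?_ (Real.exp_nonneg _)
        convert hle using 2
        ring_nf

/-- Chernoff's bound in counting form. -/
lemma card_filter_le_of_sum_exp_le {ι : Type*} (R : Finset ι) (f : ι → ℝ) {C l t : ℝ}
    (hl : 0 ≤ l) (h : ∑ i ∈ R, Real.exp (l * f i) ≤ C) :
    ((R.filter fun i => t < f i).card : ℝ) ≤ C * Real.exp (-(l * t)) := by
  have h1 : ((R.filter fun i => t < f i).card : ℝ) * Real.exp (l * t) ≤ C := by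
    refine le_trans ?_ h
    rw [← nsmul_eq_mul, ← Finset.sum_const]
    refine (Finset.sum_le_sum fun i hi => ?_).trans
      (Finset.sum_le_sum_of_subset_of_nonneg (Finset.filter_subset _ _)
        fun i _ _ => Real.exp_nonneg _)
    exact Real.exp_le_exp.2 (mul_le_mul_of_nonneg_left (Finset.mem_filter.1 hi).2.le hl)
  rw [Real.exp_neg, ← div_eq_mul_inv, le_div_iff₀ (Real.exp_pos _)]
  exact h1

/-- `|eˣ - eʸ| ≤ |x - y| (eˣ + eʸ)`, multiplied by `x - y`. -/
lemma mul_exp_sub_exp_le (k x y : ℝ) :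
    |(x - y) * (Real.exp (k * x) - Real.exp (k * y))| ≤
      |k| * ((x - y) ^ 2 * (Real.exp (k * x) + Real.exp (k * y))) := by
  have key : ∀ p q : ℝ, Real.exp p - Real.exp q ≤ |p - q| * (Real.exp p + Real.exp q) := by
    intro p q
    -- The tangent line of exp at p gives exp p - exp q ≤ (p - q) exp p.
    have h1 := Real.add_one_le_exp (q - p)
    have h2 : Real.exp q = Real.exp p * Real.exp (q - p) := by rw [← Real.exp_add]; simp
    have h3 := Real.exp_pos p
    have h4 := Real.exp_pos q
    have h5 := le_abs_self (p - q)
    have h6 := abs_nonneg (p - q)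
    nlinarith [mul_le_mul_of_nonneg_left h1 h3.le, mul_nonneg h6 h4.le,
      mul_le_mul_of_nonneg_right h5 h3.le]
  have habs : |Real.exp (k * x) - Real.exp (k * y)| ≤
      |k| * |x - y| * (Real.exp (k * x) + Real.exp (k * y)) := by
    rw [← abs_mul, mul_sub]
    refine abs_sub_le_iff.2 ⟨key _ _, ?_⟩
    rw [abs_sub_comm, add_comm (Real.exp (k * x))]
    exact key _ _
  rw [abs_mul, ← sq_abs (x - y)]
  calc _ ≤ |x - y| * (|k| * |x - y| * (Real.exp (k * x) + Real.exp (k * y))) :=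
        mul_le_mul_of_nonneg_left habs (abs_nonneg _)
    _ = _ := by ring

/-- A single term of the binomial expansion of (1 + Y/n)^n ≤ exp Y bounds the coefficient by (n/Y)^X
exp Y; as n/Y ≥ 1, the exponent X may be raised to Y. -/
lemma choose_le_exp_mul_log {n X Y : ℕ} (hY : 1 ≤ Y) (hXY : X ≤ Y) (hn : Y ≤ n) :
    (n.choose X : ℝ) ≤ Real.exp (Y * Real.log (n * Real.exp 1 / Y)) := by
  have hY0 : (0 : ℝ) < Y := by exact_mod_cast hY
  have hn0 : (0 : ℝ) < n := by exact_mod_cast (hY.trans hn)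
  have hr : (1 : ℝ) ≤ n / Y := by rw [one_le_div hY0]; exact_mod_cast hn
  have hexp : Real.exp (Y * Real.log (n * Real.exp 1 / Y)) = (n / Y : ℝ) ^ Y * Real.exp Y := by
    rw [mul_div_right_comm, mul_comm, ← Real.rpow_def_of_pos (by positivity), Real.rpow_natCast,
      mul_pow, ← Real.exp_nat_mul, mul_one]
  have hX : X ∈ Finset.range (n + 1) := Finset.mem_range.2 (by omega)
  have h1 : (Y / n : ℝ) ^ X * n.choose X ≤ Real.exp Y := by
    calc (Y / n : ℝ) ^ X * n.choose X
        ≤ ∑ m ∈ Finset.range (n + 1), (Y / n : ℝ) ^ m * 1 ^ (n - m) * n.choose m := by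
          have := Finset.single_le_sum (f := fun m => (Y / n : ℝ) ^ m * 1 ^ (n - m) * n.choose m)
            (fun m _ => by positivity) hX
          simpa using this
      _ = (Y / n + 1 : ℝ) ^ n := (add_pow _ _ _).symm
      _ ≤ Real.exp (Y / n) ^ n :=
          pow_le_pow_left₀ (by positivity) (Real.add_one_le_exp _) _
      _ = Real.exp Y := by rw [← Real.exp_nat_mul]; field_simp
  rw [hexp]
  calc (n.choose X : ℝ) = (n / Y : ℝ) ^ X * ((Y / n : ℝ) ^ X * n.choose X) := by
        rw [← mul_assoc, ← mul_pow, div_mul_div_cancel₀ hY0.ne', div_self hn0.ne']; simp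
    _ ≤ (n / Y : ℝ) ^ Y * Real.exp Y := by
        gcongr

end Concentration

/-! ### Sums over pairs of darts, and the exchangeable pair estimate. -/

section SwitchingSums

variable {V : Type*} [Fintype V] {G : SimpleGraph V} {d : ℝ}

lemma sum_darts_left (hG : ∀ x, ∑ y, adjInd G x y = d) (k : V → V → ℝ) :
    ∑ s, ∑ t, ∑ u, ∑ v, adjInd G s t * adjInd G u v * k s t =
      Fintype.card V * d * ∑ s, ∑ t, adjInd G s t * k s t := by
  simp only [mul_right_comm _ _ (k _ _), ← Finset.mul_sum, hG, Finset.sum_const,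
    Finset.card_univ, nsmul_eq_mul, ← Finset.sum_mul]
  ring

lemma sum_darts_right (hG : ∀ x, ∑ y, adjInd G x y = d) (k : V → V → ℝ) :
    ∑ s, ∑ t, ∑ u, ∑ v, adjInd G s t * adjInd G u v * k u v =
      Fintype.card V * d * ∑ s, ∑ t, adjInd G s t * k s t := by
  simp only [mul_assoc, ← Finset.mul_sum, ← Finset.sum_mul, hG, Finset.sum_const,
    Finset.card_univ, nsmul_eq_mul]
  ring

/-- For fixed s and v the free ends t and u range independently over neighbourhoods, contributing d
each. This is what produces the mean m. -/
lemma sum_darts_outer (hG : ∀ x, ∑ y, adjInd G x y = d) (k : V → V → ℝ) :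
    ∑ s, ∑ t, ∑ u, ∑ v, adjInd G s t * adjInd G u v * k s v = d ^ 2 * ∑ s, ∑ t, k s t := by
  have hG' : ∀ y, ∑ x, adjInd G x y = d := fun y => by simp only [adjInd_comm G _ y, hG]
  rw [Finset.mul_sum]
  refine Finset.sum_congr rfl fun s _ => ?_
  calc ∑ t, ∑ u, ∑ v, adjInd G s t * adjInd G u v * k s v
      = ∑ t, ∑ v, ∑ u, adjInd G s t * adjInd G u v * k s v :=
        Finset.sum_congr rfl fun t _ => Finset.sum_comm
    _ = ∑ t, adjInd G s t * (d * ∑ v, k s v) := by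
        simp only [mul_assoc, ← Finset.mul_sum, ← Finset.sum_mul, hG']
    _ = d ^ 2 * ∑ v, k s v := by rw [← Finset.sum_mul, hG]; ring

lemma sum_darts_inner (hG : ∀ x, ∑ y, adjInd G x y = d) (k : V → V → ℝ) :
    ∑ s, ∑ t, ∑ u, ∑ v, adjInd G s t * adjInd G u v * k u t = d ^ 2 * ∑ s, ∑ t, k s t := by
  have hG' : ∀ y, ∑ x, adjInd G x y = d := fun y => by simp only [adjInd_comm G _ y, hG]
  calc ∑ s, ∑ t, ∑ u, ∑ v, adjInd G s t * adjInd G u v * k u t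
      = ∑ t, ∑ s, adjInd G s t * (d * ∑ u, k u t) := by
        rw [Finset.sum_comm]
        refine Finset.sum_congr rfl fun t _ => Finset.sum_congr rfl fun s _ => ?_
        simp only [mul_assoc, ← Finset.mul_sum, ← Finset.sum_mul, hG]
    _ = d ^ 2 * ∑ t, ∑ u, k u t := by
        simp only [← Finset.sum_mul, hG']
        rw [← Finset.mul_sum, ← Finset.mul_sum]
        ring
    _ = _ := by rw [Finset.sum_comm]

/-- The decrease of the total weight of the edges when `st` and `uv` are replaced by `sv` and
`ut`. -/
def switchDiff (h : V → V → ℝ) (s t u v : V) : ℝ := h s t + h u v - h s v - h u t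

/-- The total weight of the edges of a graph, for a symmetric weight. -/
noncomputable def edgeWeight (h : V → V → ℝ) (G : SimpleGraph V) : ℝ :=
  (∑ x, ∑ y, adjInd G x y * h x y) / 2

/-- The linear regression property of the exchangeable pair: for regular graphs the total drift is
an affine function of the weight, vanishing at its heuristic mean. -/
lemma sum_darts_switchDiff (hG : ∀ x, ∑ y, adjInd G x y = d) (h : V → V → ℝ) :
    ∑ s, ∑ t, ∑ u, ∑ v, adjInd G s t * adjInd G u v * switchDiff h s t u v =
      4 * Fintype.card V * d * edgeWeight h G - 2 * d ^ 2 * ∑ x, ∑ y, h x y := by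
  simp only [switchDiff, mul_add, mul_sub, Finset.sum_add_distrib, Finset.sum_sub_distrib,
    sum_darts_left hG, sum_darts_right hG, sum_darts_inner hG, sum_darts_outer hG, edgeWeight]
  ring

/-- With p, q in [0, 2] the added and subtracted parts, (p - q)² ≤ p² + q² ≤ 2(p + q). The bound is
linear in h, so the variance proxy scales with the weight and its mean, not with the number of pairs
of darts. -/
lemma sum_darts_switchDiff_sq_le (hG : ∀ x, ∑ y, adjInd G x y = d) (h : V → V → ℝ)
    (h0 : ∀ x y, 0 ≤ h x y) (h1 : ∀ x y, h x y ≤ 1) :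
    ∑ s, ∑ t, ∑ u, ∑ v, adjInd G s t * adjInd G u v * switchDiff h s t u v ^ 2 ≤
      2 * (4 * Fintype.card V * d * edgeWeight h G + 2 * d ^ 2 * ∑ x, ∑ y, h x y) := by
  calc ∑ s, ∑ t, ∑ u, ∑ v, adjInd G s t * adjInd G u v * switchDiff h s t u v ^ 2
      ≤ ∑ s, ∑ t, ∑ u, ∑ v, adjInd G s t * adjInd G u v *
          (2 * h s t + 2 * h u v + 2 * h s v + 2 * h u t) := by
        gcongr with s _ t _ u _ v _
        · exact mul_nonneg (adjInd_nonneg _ _ _) (adjInd_nonneg _ _ _)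
        · unfold switchDiff
          have := h0 s t; have := h0 u v; have := h0 s v; have := h0 u t
          have := h1 s t; have := h1 u v; have := h1 s v; have := h1 u t
          nlinarith [mul_nonneg (add_nonneg (h0 s t) (h0 u v)) (add_nonneg (h0 s v) (h0 u t))]
    _ = _ := by
        simp only [mul_add, Finset.sum_add_distrib, mul_left_comm _ (2 : ℝ), ← Finset.mul_sum,
          sum_darts_left hG, sum_darts_right hG, sum_darts_inner hG, sum_darts_outer hG,
          edgeWeight]
        ring

open scoped Classical in
/-- Few pairs of darts cannot be switched. -/
lemma sum_darts_not_switchable_le (hG : ∀ x, ∑ y, adjInd G x y = d) :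
    ∑ s, ∑ t, ∑ u, ∑ v, (adjInd G s t * adjInd G u v - if Switchable G s t u v then 1 else 0) ≤
      2 * Fintype.card V * d * (d + d ^ 2) := by
  calc ∑ s, ∑ t, ∑ u, ∑ v,
        (adjInd G s t * adjInd G u v - if Switchable G s t u v then 1 else 0)
      -- One term for each reason to fail: the two coincidences contribute nd² each, the two edges
      -- already present nd³ each, where n is the number of vertices.
      ≤ ∑ s, ∑ t, ∑ u, ∑ v, (adjInd G s t * adjInd G u v * (if s = v then 1 else 0)
          + adjInd G s t * adjInd G u v * (if u = t then 1 else 0)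
          + adjInd G s t * adjInd G u v * adjInd G s v
          + adjInd G s t * adjInd G u v * adjInd G u t) := by
        gcongr with s _ t _ u _ v _
        have hP : 0 ≤ adjInd G s t * adjInd G u v :=
          mul_nonneg (adjInd_nonneg _ _ _) (adjInd_nonneg _ _ _)
        have hP1 : adjInd G s t * adjInd G u v ≤ 1 :=
          mul_le_one₀ (adjInd_le_one _ _ _) (adjInd_nonneg _ _ _) (adjInd_le_one _ _ _)
        have i1 : (0 : ℝ) ≤ if s = v then 1 else 0 := by split_ifs <;> norm_num
        have i2 : (0 : ℝ) ≤ if u = t then 1 else 0 := by split_ifs <;> norm_num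
        have i3 := adjInd_nonneg G s v
        have i4 := adjInd_nonneg G u t
        rw [← mul_add, ← mul_add, ← mul_add]
        by_cases hs : Switchable G s t u v
        · rw [if_pos hs]
          exact (sub_nonpos.2 hP1).trans (mul_nonneg hP (by linarith))
        rw [if_neg hs, sub_zero]
        by_cases c1 : G.Adj s t
        swap
        · simp [adjInd, c1]
        by_cases c2 : G.Adj u v
        swap
        · simp [adjInd, c2]
        refine le_mul_of_one_le_right hP ?_
        by_cases c3 : G.Adj s v
        · have : adjInd G s v = 1 := by simp [adjInd, c3]
          linarith
        by_cases c4 : G.Adj u t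
        · have : adjInd G u t = 1 := by simp [adjInd, c4]
          linarith
        by_cases c5 : s = v
        · rw [if_pos c5]; linarith
        by_cases c6 : u = t
        · rw [if_pos c6]; linarith
        exact absurd ⟨c1, c2, c3, c4, c5, c6⟩ hs
    _ = _ := by
        simp only [Finset.sum_add_distrib, sum_darts_outer hG (fun s v => if s = v then 1 else 0),
          sum_darts_inner hG (fun u t => if u = t then 1 else 0), sum_darts_outer hG (adjInd G),
          sum_darts_inner hG (adjInd G), hG]
        simp
        ring

omit [Fintype V] in
lemma abs_switchDiff_le {h : V → V → ℝ} (h0 : ∀ x y, 0 ≤ h x y) (h1 : ∀ x y, h x y ≤ 1)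
    (s t u v : V) : |switchDiff h s t u v| ≤ 2 := by
  unfold switchDiff
  have := h0 s t; have := h0 u v; have := h0 s v; have := h0 u t
  have := h1 s t; have := h1 u v; have := h1 s v; have := h1 u t
  rw [abs_le]; constructor <;> linarith

lemma Switchable.edgeWeight_switchEdges {s t u v : V} (hs : Switchable G s t u v)
    {h : V → V → ℝ} (hh : ∀ x y, h x y = h y x) :
    edgeWeight h (_root_.switchEdges G s t u v) = edgeWeight h G - switchDiff h s t u v := by
  unfold edgeWeight switchDiff
  rw [hs.sum_adjInd_mul, hh t s, hh v u, hh v s, hh t u]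
  ring

open scoped Classical in
/-- Switching is a bijection between the switchable configurations. -/
lemma sum_switchable_comm (R : Finset (SimpleGraph V)) (d : ℕ)
    (hR : ∀ G, G ∈ R ↔ G.IsRegularOfDegree d) (f : SimpleGraph V → V → V → V → V → ℝ) :
    ∑ G ∈ R, ∑ s, ∑ t, ∑ u, ∑ v, (if Switchable G s t u v then f G s t u v else 0) =
      ∑ G ∈ R, ∑ s, ∑ t, ∑ u, ∑ v,
        (if Switchable G s t u v then f (switchEdges G s t u v) s v u t else 0) := by
  have key : ∀ g : SimpleGraph V → V → V → V → V → ℝ,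
      ∑ G ∈ R, ∑ s, ∑ t, ∑ u, ∑ v, (if Switchable G s t u v then g G s t u v else 0) =
        ∑ p ∈ (R ×ˢ (Finset.univ : Finset (V × V × V × V))).filter
          (fun p => Switchable p.1 p.2.1 p.2.2.1 p.2.2.2.1 p.2.2.2.2),
          g p.1 p.2.1 p.2.2.1 p.2.2.2.1 p.2.2.2.2 := by
    intro g
    rw [Finset.sum_filter, Finset.sum_product]
    simp only [Fintype.sum_prod_type]
  rw [key, key fun G s t u v => f (switchEdges G s t u v) s v u t]
  -- Switching exchanges the roles of t and v, which makes the map an involution.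
  let φ : SimpleGraph V × V × V × V × V → SimpleGraph V × V × V × V × V := fun p =>
    (switchEdges p.1 p.2.1 p.2.2.1 p.2.2.2.1 p.2.2.2.2, p.2.1, p.2.2.2.2, p.2.2.2.1, p.2.2.1)
  have hφ : ∀ p ∈ (R ×ˢ (Finset.univ : Finset (V × V × V × V))).filter
      (fun p => Switchable p.1 p.2.1 p.2.2.1 p.2.2.2.1 p.2.2.2.2),
      φ p ∈ (R ×ˢ (Finset.univ : Finset (V × V × V × V))).filter
        (fun p => Switchable p.1 p.2.1 p.2.2.1 p.2.2.2.1 p.2.2.2.2) ∧ φ (φ p) = p := by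
    rintro ⟨G, s, t, u, v⟩ hp
    simp only [Finset.mem_filter, Finset.mem_product, Finset.mem_univ, and_true, hR] at hp
    simp only [Finset.mem_filter, Finset.mem_product, Finset.mem_univ, and_true, hR, φ,
      hp.2.switchEdges_switchEdges]
    exact ⟨hp.2.isRegularOfDegree hp.1, hp.2.switchEdges⟩
  exact (Finset.sum_nbij' φ φ (fun p hp => (hφ p hp).1) (fun p hp => (hφ p hp).1)
    (fun p hp => (hφ p hp).2) (fun p hp => (hφ p hp).2) (fun p _ => rfl)).symm

open scoped Classical in
/-- The method of exchangeable pairs for the moment generating function of an edge weight of the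
random regular graph. -/
lemma abs_sum_edgeWeight_sub_mul_exp_le (R : Finset (SimpleGraph V)) (d : ℕ) (hd : 1 ≤ d)
    (hR : ∀ G, G ∈ R ↔ G.IsRegularOfDegree d) (hV : 1 ≤ Fintype.card V) {h : V → V → ℝ}
    (hh : ∀ x y, h x y = h y x) (h0 : ∀ x y, 0 ≤ h x y) (h1 : ∀ x y, h x y ≤ 1) {m c : ℝ}
    (hm : m = d * (∑ x, ∑ y, h x y) / (2 * Fintype.card V)) (hmc : m ≤ c)
    (hc : ∀ G ∈ R, edgeWeight h G ≤ c) (k : ℝ) :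
    |∑ G ∈ R, (edgeWeight h G - m) * Real.exp (k * edgeWeight h G)| ≤
      (4 * |k| * c + (d + d ^ 2)) * ∑ G ∈ R, Real.exp (k * edgeWeight h G) := by
  set N : ℝ := (Fintype.card V : ℝ) with hN
  have hN0 : 0 < N := by rw [hN]; exact_mod_cast hV
  have hd0 : (0 : ℝ) < d := by exact_mod_cast hd
  set F : SimpleGraph V → ℝ := edgeWeight h with hF
  set E : SimpleGraph V → ℝ := fun G => Real.exp (k * F G) with hE
  have hEpos : ∀ G, 0 ≤ E G := fun G => Real.exp_nonneg _
  have hreg : ∀ G ∈ R, ∀ x, ∑ y, adjInd G x y = d := fun G hG =>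
    (isRegularOfDegree_iff_sum_adjInd G d).1 ((hR G).1 hG)
  have hsum : d ^ 2 * ∑ x, ∑ y, h x y = 2 * N * d * m := by rw [hm]; field_simp
  set A : ℝ := ∑ G ∈ R, ∑ s, ∑ t, ∑ u, ∑ v,
    (if Switchable G s t u v then switchDiff h s t u v * E G else 0) with hA
  set B : ℝ := ∑ G ∈ R, ∑ s, ∑ t, ∑ u, ∑ v,
    (adjInd G s t * adjInd G u v - if Switchable G s t u v then 1 else 0) *
      switchDiff h s t u v * E G with hB
  -- A is the drift over switchable pairs of darts; B is the error from the others.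
  have hAB : 4 * N * d * ∑ G ∈ R, (F G - m) * E G = A + B := by
    rw [hA, hB, ← Finset.sum_add_distrib, Finset.mul_sum]
    refine Finset.sum_congr rfl fun G hG => ?_
    have e1 := sum_darts_switchDiff (hreg G hG) h
    have e2 : 4 * N * d * ((F G - m) * E G) = (∑ s, ∑ t, ∑ u, ∑ v,
        adjInd G s t * adjInd G u v * switchDiff h s t u v) * E G := by
      rw [e1]; linear_combination 2 * E G * hsum
    rw [e2]
    simp only [Finset.sum_mul, ← Finset.sum_add_distrib]
    refine Finset.sum_congr rfl fun s _ => Finset.sum_congr rfl fun t _ =>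
      Finset.sum_congr rfl fun u _ => Finset.sum_congr rfl fun v _ => ?_
    split_ifs <;> ring
  have hBle : |B| ≤ 4 * N * d * (d + d ^ 2) * ∑ G ∈ R, E G := by
    rw [hB, Finset.mul_sum]
    refine (Finset.abs_sum_le_sum_abs _ _).trans (Finset.sum_le_sum fun G hG => ?_)
    calc _ ≤ ∑ s, ∑ t, ∑ u, ∑ v,
          (adjInd G s t * adjInd G u v - if Switchable G s t u v then 1 else 0) * (2 * E G) := by
          refine (Finset.abs_sum_le_sum_abs _ _).trans (Finset.sum_le_sum fun s _ => ?_)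
          refine (Finset.abs_sum_le_sum_abs _ _).trans (Finset.sum_le_sum fun t _ => ?_)
          refine (Finset.abs_sum_le_sum_abs _ _).trans (Finset.sum_le_sum fun u _ => ?_)
          refine (Finset.abs_sum_le_sum_abs _ _).trans (Finset.sum_le_sum fun v _ => ?_)
          have hw : 0 ≤ adjInd G s t * adjInd G u v - if Switchable G s t u v then 1 else 0 := by
            split_ifs with hs
            · simp [adjInd, hs.adj_st, hs.adj_uv]
            · rw [sub_zero]; exact mul_nonneg (adjInd_nonneg _ _ _) (adjInd_nonneg _ _ _)
          rw [mul_assoc, abs_mul, abs_mul, abs_of_nonneg hw, abs_of_nonneg (hEpos G)]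
          exact mul_le_mul_of_nonneg_left (mul_le_mul_of_nonneg_right
            (abs_switchDiff_le h0 h1 s t u v) (hEpos G)) hw
      _ ≤ (2 * N * d * (d + d ^ 2)) * (2 * E G) := by
          simp only [← Finset.sum_mul]
          exact mul_le_mul_of_nonneg_right (sum_darts_not_switchable_le (hreg G hG))
            (mul_nonneg zero_le_two (hEpos G))
      _ = _ := by ring
  have hAsymm : A = ∑ G ∈ R, ∑ s, ∑ t, ∑ u, ∑ v,
      (if Switchable G s t u v then
        -switchDiff h s t u v * E (switchEdges G s t u v) else 0) := by
    rw [hA, sum_switchable_comm R d hR fun G s t u v => switchDiff h s t u v * E G]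
    refine Finset.sum_congr rfl fun G _ => Finset.sum_congr rfl fun s _ =>
      Finset.sum_congr rfl fun t _ => Finset.sum_congr rfl fun u _ =>
      Finset.sum_congr rfl fun v _ => ?_
    have : switchDiff h s v u t = -switchDiff h s t u v := by unfold switchDiff; ring
    rw [this]
  set Q : ℝ := ∑ G ∈ R, ∑ s, ∑ t, ∑ u, ∑ v,
    (if Switchable G s t u v then switchDiff h s t u v ^ 2 * E G else 0) with hQ
  have hQsymm : Q = ∑ G ∈ R, ∑ s, ∑ t, ∑ u, ∑ v,
      (if Switchable G s t u v then
        switchDiff h s t u v ^ 2 * E (switchEdges G s t u v) else 0) := by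
    rw [hQ, sum_switchable_comm R d hR fun G s t u v => switchDiff h s t u v ^ 2 * E G]
    refine Finset.sum_congr rfl fun G _ => Finset.sum_congr rfl fun s _ =>
      Finset.sum_congr rfl fun t _ => Finset.sum_congr rfl fun u _ =>
      Finset.sum_congr rfl fun v _ => ?_
    have : switchDiff h s v u t = -switchDiff h s t u v := by unfold switchDiff; ring
    rw [this, neg_sq]
  -- Adding the two expressions for A, before and after switching, leaves differences of
  -- exponentials, which gain a factor |k|; the same symmetry of Q absorbs the weights of both
  -- graphs.
  have hAQ : |A + A| ≤ |k| * (Q + Q) := by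
    nth_rw 2 [hAsymm]
    nth_rw 2 [hQsymm]
    rw [hA, hQ, ← Finset.sum_add_distrib, ← Finset.sum_add_distrib, Finset.mul_sum]
    refine (Finset.abs_sum_le_sum_abs _ _).trans (Finset.sum_le_sum fun G _ => ?_)
    rw [← Finset.sum_add_distrib, ← Finset.sum_add_distrib, Finset.mul_sum]
    refine (Finset.abs_sum_le_sum_abs _ _).trans (Finset.sum_le_sum fun s _ => ?_)
    rw [← Finset.sum_add_distrib, ← Finset.sum_add_distrib, Finset.mul_sum]
    refine (Finset.abs_sum_le_sum_abs _ _).trans (Finset.sum_le_sum fun t _ => ?_)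
    rw [← Finset.sum_add_distrib, ← Finset.sum_add_distrib, Finset.mul_sum]
    refine (Finset.abs_sum_le_sum_abs _ _).trans (Finset.sum_le_sum fun u _ => ?_)
    rw [← Finset.sum_add_distrib, ← Finset.sum_add_distrib, Finset.mul_sum]
    refine (Finset.abs_sum_le_sum_abs _ _).trans (Finset.sum_le_sum fun v _ => ?_)
    split_ifs with hs
    · have e := hs.edgeWeight_switchEdges hh
      have e' : switchDiff h s t u v = F G - F (switchEdges G s t u v) := by rw [hF, e]; ring
      rw [e']
      set G' := switchEdges G s t u v
      have hle : |(F G - F G') * (E G - E G')| ≤ |k| * ((F G - F G') ^ 2 * (E G + E G')) :=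
        mul_exp_sub_exp_le k (F G) (F G')
      have r1 : (F G - F G') * E G + -(F G - F G') * E G' = (F G - F G') * (E G - E G') := by ring
      have r2 : (F G - F G') ^ 2 * E G + (F G - F G') ^ 2 * E G' =
        (F G - F G') ^ 2 * (E G + E G') := by ring
      rw [r1, r2]
      exact hle
    · simp
  -- The quadratic sum is at most 8Nd(F + m), and both F and m are at most c.
  have hQle : Q ≤ 16 * N * d * c * ∑ G ∈ R, E G := by
    rw [hQ, Finset.mul_sum]
    refine Finset.sum_le_sum fun G hG => ?_
    calc _ ≤ ∑ s, ∑ t, ∑ u, ∑ v,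
          (adjInd G s t * adjInd G u v * switchDiff h s t u v ^ 2) * E G := by
          gcongr with s _ t _ u _ v _
          split_ifs with hs
          · simp [adjInd, hs.adj_st, hs.adj_uv]
          · exact mul_nonneg (mul_nonneg (mul_nonneg (adjInd_nonneg _ _ _)
              (adjInd_nonneg _ _ _)) (sq_nonneg _)) (hEpos G)
      _ ≤ (16 * N * d * c) * E G := by
          simp only [← Finset.sum_mul]
          refine mul_le_mul_of_nonneg_right
            ((sum_darts_switchDiff_sq_le (hreg G hG) h h0 h1).trans ?_) (hEpos G)
          have e1 := mul_le_mul_of_nonneg_left (hc G hG) (mul_nonneg hN0.le hd0.le)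
          have e2 := mul_le_mul_of_nonneg_left hmc (mul_nonneg hN0.le hd0.le)
          rw [mul_assoc 2 ((d : ℝ) ^ 2), hsum]
          linarith
  have hA' : |A| ≤ |k| * (16 * N * d * c * ∑ G ∈ R, E G) := by
    have e1 : |A + A| = 2 * |A| := by rw [← two_mul, abs_mul, abs_two]
    have e2 := mul_le_mul_of_nonneg_left hQle (abs_nonneg k)
    linarith
  have hfin : 4 * N * d * |∑ G ∈ R, (F G - m) * E G| ≤
      4 * N * d * ((4 * |k| * c + (d + d ^ 2)) * ∑ G ∈ R, E G) := by
    have e1 : 4 * N * d * |∑ G ∈ R, (F G - m) * E G| = |A + B| := by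
      rw [← hAB, abs_mul, abs_of_nonneg (by positivity : 0 ≤ 4 * N * d)]
    rw [e1]
    have := abs_add_le A B
    linarith
  exact le_of_mul_le_mul_left hfin (by positivity)

end SwitchingSums

/-! ### Edge counts between two sets in the random regular graph. -/

section RandomRegular

open scoped Classical in
lemma edgesBetween_eq_sum {n : ℕ} (G : SimpleGraph (Fin n)) (S T : Finset (Fin n)) :
    (edgesBetween G S T : ℝ) = ∑ x ∈ S, ∑ y ∈ T, adjInd G x y := by
  unfold edgesBetween SimpleGraph.interedges Rel.interedges adjInd
  rw [← Finset.sum_product', Finset.sum_boole]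

/-- The indicator of the pairs with one end in `S` and the other in `T`. -/
def crossInd {V : Type*} [DecidableEq V] (S T : Finset V) (x y : V) : ℝ :=
  (if x ∈ S ∧ y ∈ T then 1 else 0) + (if y ∈ S ∧ x ∈ T then 1 else 0)

lemma crossInd_comm {V : Type*} [DecidableEq V] (S T : Finset V) (x y : V) :
    crossInd S T x y = crossInd S T y x := add_comm _ _

lemma crossInd_nonneg {V : Type*} [DecidableEq V] (S T : Finset V) (x y : V) :
    0 ≤ crossInd S T x y := by
  unfold crossInd; split_ifs <;> norm_num

lemma crossInd_le_one {V : Type*} [DecidableEq V] {S T : Finset V} (h : Disjoint S T) (x y : V) :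
    crossInd S T x y ≤ 1 := by
  unfold crossInd
  split_ifs with h1 h2
  · exact absurd h2.2 (Finset.disjoint_left.1 h h1.1)
  all_goals norm_num

lemma sum_mul_crossInd {V : Type*} [DecidableEq V] [Fintype V] (S T : Finset V) {a : V → V → ℝ}
    (ha : ∀ x y, a x y = a y x) :
    ∑ x, ∑ y, a x y * crossInd S T x y = 2 * ∑ x ∈ S, ∑ y ∈ T, a x y := by
  have e : ∑ x, ∑ y, a x y * (if x ∈ S ∧ y ∈ T then 1 else 0) = ∑ x ∈ S, ∑ y ∈ T, a x y := by
    simp [ite_and, Finset.sum_ite_mem]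
  have e' : ∑ x, ∑ y, a x y * (if y ∈ S ∧ x ∈ T then 1 else 0) = ∑ x ∈ S, ∑ y ∈ T, a x y := by
    rw [← e, Finset.sum_comm]
    simp only [ha]
  simp only [crossInd, mul_add, Finset.sum_add_distrib, e, e']
  ring

lemma edgeWeight_crossInd {n : ℕ} (G : SimpleGraph (Fin n)) (S T : Finset (Fin n)) :
    edgeWeight (crossInd S T) G = edgesBetween G S T := by
  rw [edgeWeight, sum_mul_crossInd S T (adjInd_comm G), edgesBetween_eq_sum]
  ring

lemma sum_crossInd {V : Type*} [DecidableEq V] [Fintype V] (S T : Finset V) :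
    ∑ x, ∑ y, crossInd S T x y = 2 * (S.card * T.card) := by
  have := sum_mul_crossInd S T (a := fun _ _ => 1) fun _ _ => rfl
  simpa using this

open scoped Classical in
lemma mem_regularGraphs {n d : ℕ} (G : SimpleGraph (Fin n)) :
    G ∈ regularGraphs n d ↔ G.IsRegularOfDegree d := by
  simp only [regularGraphs, Finset.mem_filter, Finset.mem_univ, true_and]

/-- This crude bound plays two roles: it is the constant c in the exchangeable pair estimate, and it
rules out deviations larger than d|S|. -/
lemma edgesBetween_le {n d : ℕ} {G : SimpleGraph (Fin n)} (hG : G ∈ regularGraphs n d)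
    (S T : Finset (Fin n)) : (edgesBetween G S T : ℝ) ≤ d * S.card := by
  classical
  rw [mem_regularGraphs, isRegularOfDegree_iff_sum_adjInd] at hG
  rw [edgesBetween_eq_sum]
  calc ∑ x ∈ S, ∑ y ∈ T, adjInd G x y ≤ ∑ x ∈ S, ∑ y, adjInd G x y :=
        Finset.sum_le_sum fun x _ => Finset.sum_le_sum_of_subset_of_nonneg
          (Finset.subset_univ _) fun y _ _ => adjInd_nonneg _ _ _
    _ = d * S.card := by simp [hG, mul_comm]

variable {n d : ℕ} {S T : Finset (Fin n)}

/-- Both tails of the number of edges between two given sets, for `e = 1` and `e = -1`. -/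
lemma card_edgesBetween_tail_le (hd : 1 ≤ d) (hn : 1 ≤ n) (hST : Disjoint S T)
    (hS : 1 ≤ S.card) {e t : ℝ} (he : |e| = 1) (ht : 0 ≤ t) :
    (((regularGraphs n d).filter fun G =>
        t < e * ((edgesBetween G S T : ℝ) - d * S.card * T.card / n)).card : ℝ) ≤
      (regularGraphs n d).card *
        Real.exp (-(t ^ 2 / (8 * d * S.card)) + (d + d ^ 2) * t / (4 * d * S.card)) := by
  have hd0 : (0 : ℝ) < d := by exact_mod_cast hd
  have hn0 : (0 : ℝ) < n := by exact_mod_cast hn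
  have hS0 : (0 : ℝ) < S.card := by exact_mod_cast hS
  set c : ℝ := d * S.card with hc
  have hc0 : 0 < c := mul_pos hd0 hS0
  set m : ℝ := d * S.card * T.card / n with hm
  have hmc : m ≤ c := by
    rw [hm, div_le_iff₀ hn0]
    have : (T.card : ℝ) ≤ n := by
      exact_mod_cast (Finset.card_le_univ T).trans_eq (Fintype.card_fin n)
    exact mul_le_mul_of_nonneg_left this hc0.le
  have key := abs_sum_edgeWeight_sub_mul_exp_le (regularGraphs n d) d hd
    (fun G => by convert mem_regularGraphs G) (by simpa using hn) (crossInd_comm S T)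
    (crossInd_nonneg S T) (crossInd_le_one hST) (m := m) (c := c)
    (by rw [sum_crossInd, Fintype.card_fin, hm]; field_simp) hmc
    (fun G hG => by rw [edgeWeight_crossInd]; exact edgesBetween_le hG S T)
  simp only [edgeWeight_crossInd] at key
  have hmgf : ∀ l : ℝ, 0 ≤ l →
      ∑ G ∈ regularGraphs n d, e * ((edgesBetween G S T : ℝ) - m) *
          Real.exp (l * (e * ((edgesBetween G S T : ℝ) - m))) ≤
        (2 * (2 * c) * l + (d + d ^ 2)) *
          ∑ G ∈ regularGraphs n d, Real.exp (l * (e * ((edgesBetween G S T : ℝ) - m))) := by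
    intro l hl
    have hexp : ∀ G : SimpleGraph (Fin n), Real.exp (l * (e * ((edgesBetween G S T : ℝ) - m))) =
        Real.exp (-(l * e * m)) * Real.exp (l * e * edgesBetween G S T) := by
      intro G
      rw [← Real.exp_add]
      ring_nf
    have hk := key (l * e)
    -- The estimate holds for k of either sign, so k = le treats both tails at once.
    rw [abs_mul, he, mul_one, abs_of_nonneg hl] at hk
    have hk' : e * ∑ G ∈ regularGraphs n d,
        ((edgesBetween G S T : ℝ) - m) * Real.exp (l * e * edgesBetween G S T) ≤
        (4 * l * c + (d + d ^ 2)) *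
          ∑ G ∈ regularGraphs n d, Real.exp (l * e * edgesBetween G S T) := by
      refine (le_abs_self _).trans ?_
      rw [abs_mul, he, one_mul]
      exact hk
    have := mul_le_mul_of_nonneg_left hk' (Real.exp_nonneg (-(l * e * m)))
    simp only [hexp, ← Finset.mul_sum]
    calc _ = Real.exp (-(l * e * m)) * (e * ∑ G ∈ regularGraphs n d,
        ((edgesBetween G S T : ℝ) - m) * Real.exp (l * e * edgesBetween G S T)) := by
          simp only [Finset.mul_sum]
          exact Finset.sum_congr rfl fun G _ => by ring
      _ ≤ _ := this
      _ = _ := by ring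
  -- This l minimises 2cl² - lt; the bias term is left out of the optimisation.
  have hl : 0 ≤ t / (4 * c) := by positivity
  refine (card_filter_le_of_sum_exp_le _ _ hl
    (sum_exp_le_of_sum_mul_exp_le _ _ (2 * c) (d + d ^ 2) hmgf hl)).trans_eq ?_
  rw [mul_assoc, ← Real.exp_add]
  congr 2
  rw [hc]
  field_simp
  ring

open scoped Classical in
/-- The deviation inequality for two given sets, with a bound strong enough for a union bound. -/
lemma card_edgesBetween_deviation_le (hd : 1 ≤ d) (hST : Disjoint S T)
    (hT : 1 ≤ T.card) :
    (((regularGraphs n d).filter fun G => ¬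
        |(edgesBetween G S T : ℝ) - (d : ℝ) * S.card * T.card / n| ≤
          (d : ℝ) * Real.sqrt ((S.card : ℝ) * T.card) *
            Real.sqrt (1 / (d : ℝ) * 24 * Real.log ((n : ℝ) * Real.exp 1 / T.card)
              + (d : ℝ) / T.card * 160)).card : ℝ) ≤
      2 * (regularGraphs n d).card *
        Real.exp (-(3 * (T.card * Real.log ((n : ℝ) * Real.exp 1 / T.card)))) := by
  have hTn : T.card ≤ n := (Finset.card_le_univ T).trans_eq (Fintype.card_fin n)
  have hd0 : (1 : ℝ) ≤ d := by exact_mod_cast hd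
  have hT0 : (0 : ℝ) < T.card := by exact_mod_cast hT
  have hn0 : (0 : ℝ) < n := by exact_mod_cast hT.trans hTn
  have hL : 0 ≤ Real.log ((n : ℝ) * Real.exp 1 / T.card) := by
    apply Real.log_nonneg
    rw [one_le_div hT0]
    have h1 : (T.card : ℝ) ≤ n := by exact_mod_cast hTn
    have h2 := Real.add_one_le_exp (1 : ℝ)
    nlinarith
  set L : ℝ := Real.log ((n : ℝ) * Real.exp 1 / T.card) with hLdef
  set m : ℝ := (d : ℝ) * S.card * T.card / n with hm
  set t : ℝ := (d : ℝ) * Real.sqrt ((S.card : ℝ) * T.card) *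
    Real.sqrt (1 / (d : ℝ) * 24 * L + (d : ℝ) / T.card * 160) with ht
  have ht0 : 0 ≤ t := by positivity
  have ht2 : t ^ 2 = d * S.card * (24 * (T.card * L) + 160 * d ^ 2) := by
    rw [ht, mul_pow, mul_pow, Real.sq_sqrt (by positivity), Real.sq_sqrt (by positivity)]
    field_simp
  have hm0 : 0 ≤ m := by positivity
  have hmc : m ≤ d * S.card := by
    rw [hm, div_le_iff₀ hn0]
    exact mul_le_mul_of_nonneg_left (by exact_mod_cast hTn) (by positivity)
  have hrhs : 0 ≤ 2 * ((regularGraphs n d).card : ℝ) * Real.exp (-(3 * (T.card * L))) := by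
    positivity
  -- Both the edge count and m lie in [0, d|S|], so a larger t is never exceeded. Empty S falls here
  -- as well.
  by_cases htc : (d : ℝ) * S.card ≤ t
  · rw [Finset.filter_eq_empty_iff.2, Finset.card_empty, Nat.cast_zero]
    · exact hrhs
    · intro G hG
      rw [not_not, abs_le]
      have h1 := edgesBetween_le hG S T
      have h2 : (0 : ℝ) ≤ edgesBetween G S T := Nat.cast_nonneg _
      constructor <;> linarith
  rw [not_le] at htc
  have hS : 1 ≤ S.card := by
    by_contra h0
    have : S.card = 0 := by omega
    rw [this] at htc
    simp only [Nat.cast_zero, mul_zero] at htc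
    linarith
  have hS0 : (0 : ℝ) < S.card := by exact_mod_cast hS
  have hexp : -(t ^ 2 / (8 * d * S.card)) + (d + d ^ 2) * t / (4 * d * S.card) ≤
      -(3 * (T.card * L)) := by
    -- Here 24 = 8·3 and 160 = 8·20. Since t < d|S|, the bias term is at most (d + d²)/4 ≤ d²/2,
    -- which 20d² absorbs.
    have e1 : t ^ 2 / (8 * d * S.card) = 3 * (T.card * L) + 20 * (d : ℝ) ^ 2 := by
      rw [ht2]; field_simp; ring
    have e2 : (d + (d : ℝ) ^ 2) * t / (4 * d * S.card) ≤ (d + (d : ℝ) ^ 2) / 4 := by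
      rw [div_le_div_iff₀ (by positivity) (by norm_num)]
      have := mul_le_mul_of_nonneg_left htc.le (by positivity : 0 ≤ (d + (d : ℝ) ^ 2))
      linarith
    have e3 : (d : ℝ) ≤ d ^ 2 := by nlinarith
    have e4 : 0 ≤ (d : ℝ) ^ 2 := sq_nonneg _
    rw [e1]
    linarith
  have hcard := Finset.card_union_le
    ((regularGraphs n d).filter fun G => t < 1 * ((edgesBetween G S T : ℝ) - m))
    ((regularGraphs n d).filter fun G => t < (-1) * ((edgesBetween G S T : ℝ) - m))
  have hsub : ((regularGraphs n d).filter fun G => ¬ |(edgesBetween G S T : ℝ) - m| ≤ t) ⊆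
      ((regularGraphs n d).filter fun G => t < 1 * ((edgesBetween G S T : ℝ) - m)) ∪
      ((regularGraphs n d).filter fun G => t < (-1) * ((edgesBetween G S T : ℝ) - m)) := by
    intro G hG
    rw [Finset.mem_filter, not_le, lt_abs] at hG
    rw [Finset.mem_union, Finset.mem_filter, Finset.mem_filter, one_mul, neg_one_mul]
    exact hG.2.imp (⟨hG.1, ·⟩) (⟨hG.1, ·⟩)
  have hle : ((((regularGraphs n d).filter fun G =>
      ¬ |(edgesBetween G S T : ℝ) - m| ≤ t).card : ℕ) : ℝ) ≤ _ :=
    Nat.cast_le.2 ((Finset.card_le_card hsub).trans hcard)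
  refine hle.trans ?_
  have hn : 1 ≤ n := hT.trans hTn
  have b1 := card_edgesBetween_tail_le hd hn hST hS (e := 1) (by simp) ht0
  have b2 := card_edgesBetween_tail_le hd hn hST hS (e := -1) (by simp) ht0
  have b3 := mul_le_mul_of_nonneg_left (Real.exp_le_exp.2 hexp)
    (Nat.cast_nonneg (α := ℝ) (regularGraphs n d).card)
  rw [Nat.cast_add]
  rw [← hm] at b1 b2
  linarith

end RandomRegular

/-! ### Union bound over the pairs of sets. -/

theorem mainTheorem8 (n d X Y : ℕ) (hd : 1 ≤ d) (hY : 1 ≤ Y) (hXY : X ≤ Y)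
    (hG : (regularGraphs n d).Nonempty) :
    1 - 2 * Real.exp (-(Y : ℝ)) ≤
      ((randomRegularGraph n d hG).toOuterMeasure
        {G | ∀ S T : Finset (Fin n), Disjoint S T → S.card = X → T.card = Y →
          |(edgesBetween G S T : ℝ) - (d : ℝ) * X * Y / n| ≤
            (d : ℝ) * Real.sqrt ((X : ℝ) * Y) *
              Real.sqrt (1 / (d : ℝ) * 24 * Real.log ((n : ℝ) * Real.exp 1 / Y)
                + (d : ℝ) / Y * 160)}).toReal := by
  classical
  have hR0 : (0 : ℝ) < (regularGraphs n d).card := by exact_mod_cast hG.card_pos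
  have hY0 : (0 : ℝ) < Y := by exact_mod_cast hY
  rw [randomRegularGraph, PMF.toOuterMeasure_uniformOfFinset_apply, ENNReal.toReal_div,
    ENNReal.toReal_natCast, ENNReal.toReal_natCast, le_div_iff₀ hR0]
  set P : SimpleGraph (Fin n) → Finset (Fin n) × Finset (Fin n) → Prop := fun G p =>
    |(edgesBetween G p.1 p.2 : ℝ) - (d : ℝ) * X * Y / n| ≤
      (d : ℝ) * Real.sqrt ((X : ℝ) * Y) *
        Real.sqrt (1 / (d : ℝ) * 24 * Real.log ((n : ℝ) * Real.exp 1 / Y)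
          + (d : ℝ) / Y * 160) with hP
  set I : Finset (Finset (Fin n) × Finset (Fin n)) :=
    (Finset.univ.powersetCard X ×ˢ Finset.univ.powersetCard Y).filter fun p => Disjoint p.1 p.2
    with hI
  have hmem : ∀ G : SimpleGraph (Fin n),
      G ∈ {G : SimpleGraph (Fin n) | ∀ S T : Finset (Fin n), Disjoint S T → S.card = X →
        T.card = Y → P G (S, T)} ↔ ∀ p ∈ I, P G p := by
    intro G
    simp only [Set.mem_ofPred_eq, hI, Finset.mem_filter, Finset.mem_product,
      Finset.mem_powersetCard_univ]
    exact ⟨fun h p hp => h p.1 p.2 hp.2 hp.1.1 hp.1.2, fun h S T h1 h2 h3 => h (S, T) ⟨⟨h2, h3⟩, h1⟩⟩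
  suffices hgood : (1 - 2 * Real.exp (-(Y : ℝ))) * (regularGraphs n d).card ≤
      (((regularGraphs n d).filter fun G => ∀ p ∈ I, P G p).card : ℝ) from
    hgood.trans <| Nat.cast_le.2 <| Finset.card_le_card fun G hG => by
      rw [Finset.mem_filter] at hG
      exact (@Finset.mem_filter _ _ (_) _ _).2 ⟨hG.1, (hmem G).2 hG.2⟩
  have hsplit := Finset.card_filter_add_card_filter_not (s := regularGraphs n d)
    (fun G => ∀ p ∈ I, P G p)
  have hsplit' : (((regularGraphs n d).filter fun G => ∀ p ∈ I, P G p).card : ℝ) +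
      ((regularGraphs n d).filter fun G => ¬ ∀ p ∈ I, P G p).card =
        (regularGraphs n d).card := by exact_mod_cast hsplit
  suffices hbad : (((regularGraphs n d).filter fun G => ¬ ∀ p ∈ I, P G p).card : ℝ) ≤
      2 * Real.exp (-(Y : ℝ)) * (regularGraphs n d).card by linarith
  -- If Y > n there is no set T, and no graph is bad.
  by_cases hYn : Y ≤ n
  swap
  · have hIe : I = ∅ := by
      rw [hI, Finset.powersetCard_eq_empty (n := Y).2 (by simpa using hYn)]
      simp
    simp only [hIe, Finset.notMem_empty, false_imp_iff, implies_true, not_true_eq_false,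
      Finset.filter_false, Finset.card_empty, Nat.cast_zero]
    positivity
  have hunion : ((regularGraphs n d).filter fun G => ¬ ∀ p ∈ I, P G p) ⊆
      I.biUnion fun p => (regularGraphs n d).filter fun G => ¬ P G p := by
    intro G hG
    rw [Finset.mem_filter] at hG
    obtain ⟨hGR, hGp⟩ := hG
    push Not at hGp
    obtain ⟨p, hp, hpG⟩ := hGp
    exact Finset.mem_biUnion.2 ⟨p, hp, Finset.mem_filter.2 ⟨hGR, hpG⟩⟩
  have hL1 : 1 ≤ Real.log ((n : ℝ) * Real.exp 1 / Y) := by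
    rw [Real.le_log_iff_exp_le (by have : (0 : ℝ) < n := by exact_mod_cast hY.trans hYn
                                   positivity), le_div_iff₀ hY0, mul_comm]
    exact mul_le_mul_of_nonneg_right (by exact_mod_cast hYn) (Real.exp_nonneg _)
  set L : ℝ := Real.log ((n : ℝ) * Real.exp 1 / Y) with hL
  have hsum : (((regularGraphs n d).filter fun G => ¬ ∀ p ∈ I, P G p).card : ℝ) ≤
      ∑ p ∈ I, (((regularGraphs n d).filter fun G => ¬ P G p).card : ℝ) := by
    exact_mod_cast (Finset.card_le_card hunion).trans Finset.card_biUnion_le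
  have hIcard : (I.card : ℝ) ≤ Real.exp (Y * L) * Real.exp (Y * L) := by
    calc (I.card : ℝ) ≤ (n.choose X : ℝ) * n.choose Y := by
          exact_mod_cast (Finset.card_filter_le _ _).trans_eq (by simp)
      _ ≤ _ := mul_le_mul (choose_le_exp_mul_log hY hXY hYn)
          (choose_le_exp_mul_log hY le_rfl hYn) (Nat.cast_nonneg _) (Real.exp_nonneg _)
  calc (((regularGraphs n d).filter fun G => ¬ ∀ p ∈ I, P G p).card : ℝ)
      ≤ ∑ p ∈ I, (((regularGraphs n d).filter fun G => ¬ P G p).card : ℝ) := hsum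
    _ ≤ ∑ _p ∈ I, 2 * ((regularGraphs n d).card : ℝ) * Real.exp (-(3 * (Y * L))) := by
        refine Finset.sum_le_sum fun p hp => ?_
        simp only [hI, Finset.mem_filter, Finset.mem_product,
          Finset.mem_powersetCard_univ] at hp
        obtain ⟨⟨h1, h2⟩, h3⟩ := hp
        have := card_edgesBetween_deviation_le (n := n) hd h3 (by omega)
        rw [h1, h2] at this
        exact this
    _ = I.card * (2 * ((regularGraphs n d).card : ℝ) * Real.exp (-(3 * (Y * L)))) := by
        rw [Finset.sum_const, nsmul_eq_mul]
    _ ≤ Real.exp (Y * L) * Real.exp (Y * L) *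
          (2 * ((regularGraphs n d).card : ℝ) * Real.exp (-(3 * (Y * L)))) :=
        mul_le_mul_of_nonneg_right hIcard (by positivity)
    _ = 2 * Real.exp (-(Y * L)) * (regularGraphs n d).card := by
        rw [show -(Y * L) = Y * L + Y * L + -(3 * (Y * L)) by ring, Real.exp_add, Real.exp_add]
        ring
    _ ≤ 2 * Real.exp (-(Y : ℝ)) * (regularGraphs n d).card := by
        gcongr
        exact le_mul_of_one_le_right hY0.le hL1
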